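/- A single production system has deterioration levels $\{0,1,\dots,\xi\}$; it fails when level $\xi$ is reached. Production rates are $s\in\mathcal S=[0,\bar s]$ with $0<\bar s<\infty$. While the production rate is $s$, the level increases by one with intensity $\lambda f(s)$, where $\lambda\ge 0$ is a known base rate, and revenue is earned at rate $r(s)$. The functions $f,r$ are continuous and (weakly) increasing on $\mathcal S$, with $f(0)=0$ and $r(0)\le 0$. A failed system is switched off ($s=0$); its revenue rate is a fixed constant $\rho$, with $\rho=r(0)$ or $\rho=0$ (both conventions are covered). At the scheduled maintenance moment a cost $c_m(x)\ge 0$ is incurred, depending on the level $x$ at that moment, with $c_m$ increasing and convex on $\{0,\dots,\xi\}$. An admissible policy is a measurable non-anticipating policy: the production rate at each moment lies in $[0,\bar s]$, is a function of the current time and of the times of the level increments so far, and is $0$ when the system has failed. The expected profit $J^u(x,t)$ of policy $u$, from level $x$ with time $t\ge 0$ until the scheduled maintenance moment, is the expected revenue accumulated until that moment minus the expected maintenance cost. A Markov policy prescribes the production rate $s(x,t)\in[0,\bar s]$ as a measurable function of the current level $x$ and the remaining time $t$, with $s(\xi,t)=0$; it is optimal if for all $x\in\{0,\dots,\xi\}$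 and $t\ge0$ it attains the maximum of $J^u(x,t)$ over all admissible policies $u$. It is bang-bang if $s(x,t)\in\{0,\bar s\}$ for all $(x,t)$. There exists an optimal Markov policy that is bang-bang if any of the following conditions is satisfied: (i) $r(s)=f(s)$ for all $s\in\mathcal S$; (ii) there are real constants $a,b,\alpha,\beta$ with $\alpha\ge\beta$ such that $r(s)=a\,s^\alpha$ and $f(s)=b\,s^\beta$ for all $s\in\mathcal S$; (iii) $r$ is convex on $\mathcal S$ and $f$ is concave on $\mathcal S$. -/

import Mathlib

open MeasureTheory ProbabilityTheory Set
open scoped ENNReal NNReal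

noncomputable section

namespace CondProd

/-- A production system with condition-based production control. -/
structure Model where
  /-- failure level; the deterioration levels are `0, 1, …, ξ` -/
  ξ : ℕ
  /-- maximum production rate; the production rates are `[0, smax]` -/
  smax : ℝ
  smax_pos : 0 < smax
  /-- base rate of the deterioration -/
  base : ℝ
  base_nonneg : 0 ≤ base
  /-- deterioration function on `[0, smax]` -/
  f : ℝ → ℝ
  f_cont : ContinuousOn f (Icc 0 smax)
  f_mono : MonotoneOn f (Icc 0 smax)
  f_zero : f 0 = 0
  /-- revenue function on `[0, smax]` -/
  r : ℝ → ℝ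
  r_cont : ContinuousOn r (Icc 0 smax)
  r_mono : MonotoneOn r (Icc 0 smax)
  r_zero : r 0 ≤ 0
  /-- maintenance cost as a function of the deterioration level -/
  c : ℕ → ℝ
  c_nonneg : ∀ x ≤ ξ, 0 ≤ c x
  c_mono : ∀ x, x + 1 ≤ ξ → c x ≤ c (x + 1)
  c_convex : ∀ x, x + 2 ≤ ξ → c (x + 1) - c x ≤ c (x + 2) - c (x + 1)
  /-- revenue rate of a failed (hence switched off) system: either `r 0`, the revenue rate of
  any system that is off, or `0`, when a failed system neither earns nor loses anything -/
  rFail : ℝ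
  rFail_eq : rFail = r 0 ∨ rFail = 0

/-- An admissible non-anticipating policy for a system that starts at level `x`. Time is the time
elapsed since the start. `rate n h k` is the production rate at time `k` when exactly `n`
deterioration increments have occurred so far, at the times `h 0 ≤ … ≤ h (n - 1)`.
A failed system is switched off. -/
structure Policy (M : Model) (x : ℕ) where
  rate : (n : ℕ) → (Fin n → ℝ≥0∞) → ℝ → ℝ
  measurable_rate : ∀ n, Measurable (fun p : (Fin n → ℝ≥0∞) × ℝ => rate n p.1 p.2)
  rate_mem : ∀ n h k, rate n h k ∈ Icc 0 M.smax
  off : ∀ n h k, M.ξ ≤ x + n → rate n h k = 0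

/-- A Markov policy: `rate x t` is the production rate at deterioration level `x` when the time
to the scheduled maintenance moment is `t`. -/
structure MarkovPolicy (M : Model) where
  rate : ℕ → ℝ → ℝ
  measurable_rate : ∀ x, Measurable (rate x)
  rate_mem : ∀ x t, rate x t ∈ Icc 0 M.smax
  off : ∀ x t, M.ξ ≤ x → rate x t = 0

/-- The policy that a Markov policy induces when the system starts at level `x` with time `t`
to the scheduled maintenance moment. -/
def MarkovPolicy.toPolicy {M : Model} (s : MarkovPolicy M) (x : ℕ) (t : ℝ) : Policy M x where
  rate n _ k := s.rate (x + n) (t - k)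
  measurable_rate n :=
    (s.measurable_rate (x + n)).comp (measurable_const.sub measurable_snd)
  rate_mem n _ k := s.rate_mem (x + n) (t - k)
  off n _ k h := s.off (x + n) (t - k) h

variable {M : Model} {x : ℕ}

/-- The time of the next increment after increments at the times `h`: the first time at which the
intensity `base * f (production rate)`, accumulated since the last increment, reaches the
threshold `e` (`⊤` if this never happens). -/
def nextJump (u : Policy M x) (n : ℕ) (h : Fin n → ℝ≥0∞) (e : ℝ) : ℝ≥0∞ :=
  ⨅ (k : ℝ≥0) (_ : (⨆ i, h i) ≤ (k : ℝ≥0∞) ∧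
      e ≤ ∫ v in (⨆ i, h i).toReal..(k : ℝ), M.base * M.f (u.rate n h v)), (k : ℝ≥0∞)

/-- The first `n` increment times, driven by the thresholds `ω 0, ω 1, …`. -/
def jumpTimes (u : Policy M x) (ω : ℕ → ℝ) : (n : ℕ) → Fin n → ℝ≥0∞
  | 0 => Fin.elim0
  | n + 1 => Fin.snoc (α := fun _ => ℝ≥0∞) (jumpTimes u ω n)
      (nextJump u n (jumpTimes u ω n) (ω n))

/-- The number of increments up to and including time `k`; at level `ξ` the intensity is zero, so
that there are at most `ξ - x` of them. -/
def numJumps (u : Policy M x) (ω : ℕ → ℝ) (k : ℝ) : ℕ :=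
  ((Finset.range (M.ξ - x)).filter
    (fun n => jumpTimes u ω (n + 1) (Fin.last n) ≤ ENNReal.ofReal k)).card

/-- The deterioration level at time `k`. -/
def level (u : Policy M x) (ω : ℕ → ℝ) (k : ℝ) : ℕ := x + numJumps u ω k

/-- The production rate at time `k`. -/
def prodRate (u : Policy M x) (ω : ℕ → ℝ) (k : ℝ) : ℝ :=
  u.rate (numJumps u ω k) (jumpTimes u ω (numJumps u ω k)) k

/-- The revenue rate at time `k`. -/
def revenueRate (u : Policy M x) (ω : ℕ → ℝ) (k : ℝ) : ℝ :=
  if level u ω k < M.ξ then M.r (prodRate u ω k) else M.rFail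

/-- The law of a sequence of independent standard exponential thresholds. With these thresholds the
deterioration increases with intensity `base * f (production rate)`. -/
def thresholdLaw : Measure (ℕ → ℝ) := Measure.infinitePi (fun _ => expMeasure 1)

/-- Expected profit from level `x` with time `t` to the scheduled maintenance moment. -/
def profit (u : Policy M x) (t : ℝ) : ℝ :=
  ∫ ω, ((∫ k in (0 : ℝ)..t, revenueRate u ω k) - M.c (level u ω t)) ∂thresholdLaw

/-- A Markov policy is optimal if from every level and every time to maintenance it attains the
largest expected profit among all admissible non-anticipating policies. -/
def MarkovPolicy.IsOptimal (s : MarkovPolicy M) : Prop :=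
  ∀ x ≤ M.ξ, ∀ t : ℝ, 0 ≤ t →
    IsGreatest (Set.range fun u : Policy M x => profit u t) (profit (s.toPolicy x t) t)

/-- Production is always either at the maximum rate or off. -/
def MarkovPolicy.IsBangBang (s : MarkovPolicy M) : Prop :=
  ∀ x t, s.rate x t = 0 ∨ s.rate x t = M.smax

end CondProd

end

/-! The proof is a verification argument. Write μ for the intensity at full rate. Backwards from
V_ξ(t) = -c(ξ) + ρ t, let V_n solve V_n' = max(r(0), r(smax) - μ (V_n - V_{n+1})) with V_n(0) =
-c(n). This is the Hamilton-Jacobi-Bellman equation in which only the rates 0 and smax compete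
(`exists_value_functions`). Each of the three conditions makes these rates sufficient: for every
real D, r(s) - f(s) D is at most the larger of its values at 0 and smax (`Model.sub_mul_le_max`).
Hence V solves the equation with the full control set as well.

Along every trajectory of every policy, the realized profit telescopes into V_x(t) plus one gain per
sojourn between increments (`realized_profit_eq`). The next threshold is exponential and independent
of the past (`map_jumpTimes_threshold`). So, given the past, the expected gain of a sojourn is an
integral of the survival probability times r(s) - λ f(s) (V_n - V_{n+1}) - V_n'
(`integral_sojournGain_of_le`). The last factor is nonpositive for every admissible rate and zero
for the greedy one. Thus V bounds every profit, and the greedy policy, which is bang-bang, attains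
it. -/

noncomputable section

namespace CondProd

/-! ### Global ODE solutions and the value functions -/

/-- A globally Lipschitz scalar ODE whose right-hand side grows at most exponentially has a global
solution that grows at most exponentially. -/
lemma exists_global_solution {g : ℝ → ℝ → ℝ} (hg : Continuous fun p : ℝ × ℝ => g p.1 p.2)
    {L κ C : ℝ} (hL : 0 ≤ L) (hκ : 2 * L + 1 ≤ κ)
    (hlip : ∀ s y z, |g s y - g s z| ≤ L * |y - z|)
    (hbd : ∀ s, 0 ≤ s → |g s 0| ≤ C * Real.exp (κ * s)) (y₀ : ℝ) :
    ∃ V V' : ℝ → ℝ, Continuous V' ∧ (∀ t, HasDerivAt V (V' t) t) ∧ V 0 = y₀ ∧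
      (∀ t, 0 ≤ t → V' t = g t (V t)) ∧
      ∃ B, ∀ t, 0 ≤ t → |V t| ≤ B * Real.exp (κ * t) := by
  have hκ0 : 0 < κ := by linarith
  have hC : 0 ≤ C := by simpa using (abs_nonneg _).trans (hbd 0 le_rfl)
  have hexp : ∀ t : ℝ, 0 ≤ t → ∫ s in (0 : ℝ)..t, Real.exp (κ * s) ≤ Real.exp (κ * t) / κ := by
    intro t _
    rw [intervalIntegral.integral_comp_mul_left (fun s => Real.exp s) hκ0.ne', integral_exp]
    simp only [smul_eq_mul, mul_zero, Real.exp_zero]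
    rw [inv_mul_eq_div]
    gcongr
    linarith
  have hrhs : ∀ Y : ℝ → ℝ, Continuous Y → Continuous fun s => g s (Real.exp (κ * s) * Y s) :=
    fun Y hY => hg.comp (continuous_id.prodMk (by fun_prop))
  have hint : ∀ (Y : ℝ → ℝ), Continuous Y → Continuous fun t =>
      ∫ s in (0 : ℝ)..t, g s (Real.exp (κ * s) * Y s) :=
    fun Y hY => intervalIntegral.continuous_primitive
      (fun a b => (hrhs Y hY).intervalIntegrable a b) 0
  have hbound : ∀ Y : BoundedContinuousFunction ℝ ℝ, ∀ t : ℝ, 0 ≤ t →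
      |Real.exp (-(κ * t)) * (y₀ + ∫ s in (0 : ℝ)..t, g s (Real.exp (κ * s) * Y s))|
        ≤ |y₀| + (C + L * ‖Y‖) / κ := by
    intro Y t ht
    have h1 : |∫ s in (0 : ℝ)..t, g s (Real.exp (κ * s) * Y s)|
        ≤ (C + L * ‖Y‖) * (Real.exp (κ * t) / κ) := by
      calc |∫ s in (0 : ℝ)..t, g s (Real.exp (κ * s) * Y s)|
          ≤ ∫ s in (0 : ℝ)..t, (C + L * ‖Y‖) * Real.exp (κ * s) := by
            refine intervalIntegral.norm_integral_le_of_norm_le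
              (f := fun s => g s (Real.exp (κ * s) * Y s)) ht ?_ ?_
            · refine Filter.Eventually.of_forall fun s hs => ?_
              have h2 := hlip s (Real.exp (κ * s) * Y s) 0
              have h3 := hbd s hs.1.le
              have h4 : |Real.exp (κ * s) * Y s - 0| ≤ Real.exp (κ * s) * ‖Y‖ := by
                rw [sub_zero, abs_mul, abs_of_pos (Real.exp_pos _)]
                gcongr
                exact Y.norm_coe_le_norm s
              have h5 := mul_le_mul_of_nonneg_left h4 hL
              have h6 := abs_sub_abs_le_abs_sub (g s (Real.exp (κ * s) * Y s)) (g s 0)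
              rw [Real.norm_eq_abs]
              linarith
            · exact (by fun_prop : Continuous fun s : ℝ =>
                (C + L * ‖Y‖) * Real.exp (κ * s)).intervalIntegrable _ _
        _ ≤ _ := by
            rw [intervalIntegral.integral_const_mul]
            have := hexp t ht
            gcongr
    rw [abs_mul, abs_of_pos (Real.exp_pos _)]
    have h2 : Real.exp (-(κ * t)) ≤ 1 := Real.exp_le_one_iff.2 (by nlinarith)
    have h3 : Real.exp (-(κ * t)) * Real.exp (κ * t) = 1 := by rw [← Real.exp_add]; simp
    calc Real.exp (-(κ * t)) * |y₀ + ∫ s in (0 : ℝ)..t, g s (Real.exp (κ * s) * Y s)|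
        ≤ Real.exp (-(κ * t)) * (|y₀| + (C + L * ‖Y‖) * (Real.exp (κ * t) / κ)) := by
          gcongr
          exact (abs_add_le _ _).trans (by gcongr)
      _ = Real.exp (-(κ * t)) * |y₀|
          + (C + L * ‖Y‖) / κ * (Real.exp (-(κ * t)) * Real.exp (κ * t)) := by ring
      _ ≤ 1 * |y₀| + (C + L * ‖Y‖) / κ * 1 := by rw [h3]; gcongr
      _ = _ := by ring
  -- Picard operator for the rescaled unknown Y(t) = exp(-κ t) V(t). The weight makes it a
  -- contraction on the whole half-line, with constant L / κ ≤ 1 / 2. The truncation `max t 0` lets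
  -- it act on functions on all of ℝ while the growth bounds are only used at nonnegative times.
  let Ψ : BoundedContinuousFunction ℝ ℝ → BoundedContinuousFunction ℝ ℝ := fun Y =>
    BoundedContinuousFunction.ofNormedAddCommGroup
      (fun t => Real.exp (-(κ * max t 0)) *
        (y₀ + ∫ s in (0 : ℝ)..(max t 0), g s (Real.exp (κ * s) * Y s)))
      (by
        have := (hint Y Y.continuous).comp (continuous_id.max (continuous_const (y := (0 : ℝ))))
        exact (by fun_prop : Continuous fun t : ℝ => Real.exp (-(κ * max t 0))).mul
          (continuous_const.add this))
      (|y₀| + (C + L * ‖Y‖) / κ) (fun t => hbound Y _ (le_max_right _ _))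
  have hΨ : ∀ Y t, Ψ Y t = Real.exp (-(κ * max t 0)) *
        (y₀ + ∫ s in (0 : ℝ)..(max t 0), g s (Real.exp (κ * s) * Y s)) := fun _ _ => rfl
  have hcontr : ContractingWith (1 / 2) Ψ := by
    refine ⟨by norm_num, LipschitzWith.of_dist_le_mul fun Y Z => ?_⟩
    rw [BoundedContinuousFunction.dist_le (by positivity)]
    intro t
    rw [hΨ, hΨ, Real.dist_eq, ← mul_sub, add_sub_add_left_eq_sub,
      ← intervalIntegral.integral_sub ((hrhs Y Y.continuous).intervalIntegrable _ _)
        ((hrhs Z Z.continuous).intervalIntegrable _ _), abs_mul, abs_of_pos (Real.exp_pos _)]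
    set m := max t 0
    have hm : 0 ≤ m := le_max_right _ _
    have h1 : |∫ s in (0 : ℝ)..m, (g s (Real.exp (κ * s) * Y s) - g s (Real.exp (κ * s) * Z s))|
        ≤ L * dist Y Z * (Real.exp (κ * m) / κ) := by
      calc _ ≤ ∫ s in (0 : ℝ)..m, (L * dist Y Z) * Real.exp (κ * s) := by
            refine intervalIntegral.norm_integral_le_of_norm_le (f := fun s =>
              g s (Real.exp (κ * s) * Y s) - g s (Real.exp (κ * s) * Z s)) hm ?_ ?_
            · refine Filter.Eventually.of_forall fun s hs => ?_
              rw [Real.norm_eq_abs]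
              refine (hlip _ _ _).trans ?_
              rw [← mul_sub, abs_mul, abs_of_pos (Real.exp_pos _), mul_comm (Real.exp _),
                ← mul_assoc]
              gcongr
              exact BoundedContinuousFunction.dist_coe_le_dist (f := Y) (g := Z) s
            · exact (by fun_prop : Continuous fun s : ℝ =>
                (L * dist Y Z) * Real.exp (κ * s)).intervalIntegrable _ _
        _ ≤ _ := by
            rw [intervalIntegral.integral_const_mul]
            have := hexp m hm
            gcongr
    have h3 : Real.exp (-(κ * m)) * Real.exp (κ * m) = 1 := by rw [← Real.exp_add]; simp
    have h4 : L / κ ≤ 1 / 2 := by rw [div_le_div_iff₀ hκ0 two_pos]; linarith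
    calc _ ≤ Real.exp (-(κ * m)) * (L * dist Y Z * (Real.exp (κ * m) / κ)) := by gcongr
      _ = L / κ * dist Y Z * (Real.exp (-(κ * m)) * Real.exp (κ * m)) := by ring
      _ ≤ 1 / 2 * dist Y Z := by rw [h3, mul_one]; gcongr
      _ = _ := by simp
  obtain ⟨Y, hY⟩ : ∃ Y, Ψ Y = Y := ⟨_, hcontr.fixedPoint_isFixedPt⟩
  have hG := hrhs Y Y.continuous
  set G : ℝ → ℝ := fun s => g s (Real.exp (κ * s) * Y s) with hGdef
  have hV : ∀ t, 0 ≤ t → y₀ + ∫ s in (0 : ℝ)..t, G s = Real.exp (κ * t) * Y t := by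
    intro t ht
    have h1 := hΨ Y t
    rw [hY, max_eq_left ht] at h1
    rw [h1, ← mul_assoc, ← Real.exp_add]
    simp [hGdef]
  -- V is the primitive of the continuous function G, hence differentiable everywhere; G agrees with
  -- the right-hand side along V only for t ≥ 0.
  refine ⟨fun t => y₀ + ∫ s in (0 : ℝ)..t, G s, G, hG, fun t => ?_, by simp, fun t ht => ?_,
    ‖Y‖, fun t ht => ?_⟩
  · exact (intervalIntegral.integral_hasDerivAt_right (hG.intervalIntegrable _ _)
      (hG.stronglyMeasurableAtFilter _ _) hG.continuousAt).const_add _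
  · beta_reduce
    rw [hV t ht]
  · beta_reduce
    rw [hV t ht, abs_mul, abs_of_pos (Real.exp_pos _), mul_comm]
    gcongr
    exact Y.norm_coe_le_norm t

/-- Solutions of the Hamilton-Jacobi-Bellman equations with control set `{0, smax}`. -/
lemma exists_value_functions (r₀ r₁ ρ : ℝ) {μ : ℝ} (hμ : 0 ≤ μ) (c : ℕ → ℝ) (N : ℕ) :
    ∃ V V' : ℕ → ℝ → ℝ, (∀ n, Continuous (V' n)) ∧ (∀ n t, HasDerivAt (V n) (V' n t) t) ∧
      (∀ n ≤ N, V n 0 = -c n) ∧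
      (∀ n < N, ∀ t, 0 ≤ t → V' n t = max r₀ (r₁ - μ * (V n t - V (n + 1) t))) ∧
      ∀ t, V N t = -c N + ρ * t := by
  -- One growth rate serves all levels: the bound obtained for the solution at one level is the
  -- forcing bound needed at the level below it.
  set κ := 2 * μ + 1 with hκ
  let Good : (ℝ → ℝ) × (ℝ → ℝ) → Prop := fun p => Continuous p.2 ∧
    (∀ t, HasDerivAt p.1 (p.2 t) t) ∧ ∃ B, ∀ t, 0 ≤ t → |p.1 t| ≤ B * Real.exp (κ * t)
  have step : ∀ (y₀ : ℝ) (p : {p // Good p}), ∃ q : {p // Good p}, q.1.1 0 = y₀ ∧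
      ∀ t, 0 ≤ t → q.1.2 t = max r₀ (r₁ - μ * (q.1.1 t - p.1.1 t)) := by
    rintro y₀ ⟨⟨W, W'⟩, hW', hW, B, hB⟩
    have hWc : Continuous W := continuous_iff_continuousAt.2 fun t => (hW t).continuousAt
    obtain ⟨V, V', h1, h2, h3, h4, h5⟩ := exists_global_solution
      (g := fun s y => max r₀ (r₁ - μ * (y - W s))) (by fun_prop) (C := |r₀| + |r₁| + μ * B)
      hμ hκ.ge
      (fun s y z => by
        rw [max_comm r₀, max_comm r₀]
        refine (abs_max_sub_max_le_abs _ _ _).trans (le_of_eq ?_)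
        rw [show r₁ - μ * (y - W s) - (r₁ - μ * (z - W s)) = -(μ * (y - z)) by ring, abs_neg,
          abs_mul, abs_of_nonneg hμ])
      (fun s hs => by
        have h1 := hB s hs
        have h2 : 1 ≤ Real.exp (κ * s) := Real.one_le_exp (by positivity)
        have h3 : |max r₀ (r₁ - μ * (0 - W s))| ≤ |r₀| + |r₁ - μ * (0 - W s)| :=
          abs_max_le_max_abs_abs.trans (max_le (by linarith [abs_nonneg (r₁ - μ * (0 - W s))])
            (by linarith [abs_nonneg r₀]))
        have h4 : |r₁ - μ * (0 - W s)| ≤ |r₁| + μ * |W s| := by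
          have := abs_add_le r₁ (μ * W s)
          rw [abs_mul, abs_of_nonneg hμ] at this
          rwa [zero_sub, mul_neg, sub_neg_eq_add]
        have h5 := mul_le_mul_of_nonneg_left h1 hμ
        have h6 := mul_le_mul_of_nonneg_left h2 (add_nonneg (abs_nonneg r₀) (abs_nonneg r₁))
        linarith) y₀
    exact ⟨⟨(V, V'), h1, h2, h5⟩, h3, h4⟩
  choose F hF₀ hF using step
  have hbase : Good (fun t => -c N + ρ * t, fun _ => ρ) := by
    refine ⟨continuous_const, fun t => ?_, |c N| + |ρ|, fun t ht => ?_⟩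
    · simpa using ((hasDerivAt_id t).const_mul ρ).const_add (-c N)
    · have h1 : 1 ≤ Real.exp (κ * t) := Real.one_le_exp (by positivity)
      have h2 : t ≤ Real.exp (κ * t) := by
        have := Real.add_one_le_exp (κ * t)
        nlinarith [mul_nonneg hμ ht]
      have h3 := abs_add_le (-c N) (ρ * t)
      rw [abs_neg, abs_mul, abs_of_nonneg ht] at h3
      have h4 := mul_le_mul_of_nonneg_left h1 (abs_nonneg (c N))
      have h5 := mul_le_mul_of_nonneg_left h2 (abs_nonneg ρ)
      dsimp only
      linarith
  -- Recursion on the number k of levels left before failure: `U k` belongs to level N - k. Levels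
  -- beyond N repeat level N, by truncated subtraction.
  let U : ℕ → {p // Good p} := fun k =>
    Nat.rec ⟨_, hbase⟩ (fun k p => F (-c (N - (k + 1))) p) k
  refine ⟨fun n => (U (N - n)).1.1, fun n => (U (N - n)).1.2, fun n => (U (N - n)).2.1,
    fun n => (U (N - n)).2.2.1, fun n hn => ?_, fun n hn t ht => ?_, fun t => ?_⟩
  · rcases hn.eq_or_lt with rfl | hn
    · simp [U]
    · obtain ⟨k, hk⟩ : ∃ k, N - n = k + 1 := ⟨N - n - 1, by omega⟩
      simp only [hk]
      refine (hF₀ _ _).trans ?_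
      congr 2; omega
  · obtain ⟨k, hk⟩ : ∃ k, N - n = k + 1 := ⟨N - n - 1, by omega⟩
    have hk' : N - (n + 1) = k := by omega
    simp only [hk, hk']
    exact hF _ _ t ht
  · simp [U]

/-! ### Sufficiency of the extreme rates -/

/-- Only the extreme production rates matter in the Hamilton-Jacobi-Bellman equations. -/
lemma Model.sub_mul_le_max (M : Model)
    (h : (∀ s ∈ Set.Icc 0 M.smax, M.r s = M.f s) ∨
      (∃ a b α β : ℝ, β ≤ α ∧
        (∀ s ∈ Set.Icc 0 M.smax, M.r s = a * s ^ α) ∧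
        (∀ s ∈ Set.Icc 0 M.smax, M.f s = b * s ^ β)) ∨
      (ConvexOn ℝ (Set.Icc 0 M.smax) M.r ∧ ConcaveOn ℝ (Set.Icc 0 M.smax) M.f))
    (D : ℝ) {s : ℝ} (hs : s ∈ Icc 0 M.smax) :
    M.r s - M.f s * D ≤ max (M.r 0) (M.r M.smax - M.f M.smax * D) := by
  have h0 : (0 : ℝ) ∈ Icc 0 M.smax := ⟨le_rfl, M.smax_pos.le⟩
  have h1 : M.smax ∈ Icc 0 M.smax := ⟨M.smax_pos.le, le_rfl⟩
  have hf1 := M.f_mono hs h1 hs.2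
  have hr1 := M.r_mono hs h1 hs.2
  have hf0 := M.f_mono h0 hs hs.1
  rw [M.f_zero] at hf0
  -- For D ≤ 0 both r(s) and -f(s) D increase in s, so smax is best under any of the conditions.
  rcases le_or_gt D 0 with hD | hD
  · exact le_max_of_le_right (by nlinarith)
  rcases h with h | ⟨a, b, α, β, hαβ, hr, hf⟩ | ⟨hr, hf⟩
  · rw [h s hs, h 0 h0, h _ h1, M.f_zero]
    rcases le_or_gt D 1 with hD1 | hD1
    · exact le_max_of_le_right (by nlinarith)
    · exact le_max_of_le_left (by nlinarith)
  · rcases hs.1.eq_or_lt with rfl | hs0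
    · rw [M.f_zero]; simp
    rcases eq_or_ne (M.f M.smax) 0 with hfz | hfz
    · have : M.f s = 0 := le_antisymm (hfz ▸ hf1) hf0
      exact le_max_of_le_right (by rw [this, hfz]; linarith)
    have hfp : 0 < M.f M.smax := lt_of_le_of_ne (hf0.trans hf1) hfz.symm
    have hsp : 0 < M.smax ^ β := Real.rpow_pos_of_pos M.smax_pos _
    have hb : 0 < b := by
      rw [hf _ h1] at hfp
      exact pos_of_mul_pos_left hfp hsp.le
    -- β = 0 would give f(0) = b > 0. For β < 0 the convention `0 ^ β = 0` is consistent with f(0) =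
    -- 0, so continuity is needed: f(smax / (n + 1)) ≥ f(smax) > 0 contradicts the limit f(0) = 0.
    have hβ : 0 < β := by
      by_contra hβ
      rcases (not_lt.1 hβ).eq_or_lt with rfl | hβ
      · have := hf 0 h0
        rw [M.f_zero, Real.rpow_zero] at this
        linarith
      · have hc : Filter.Tendsto (fun n : ℕ => M.f (M.smax / (n + 1))) Filter.atTop
            (nhds (M.f 0)) := by
          have h2 : Filter.Tendsto (fun n : ℕ => M.smax / ((n : ℝ) + 1)) Filter.atTop
              (nhds 0) := by
            simpa [div_eq_mul_inv] using
              (tendsto_one_div_add_atTop_nhds_zero_nat (𝕜 := ℝ)).const_mul M.smax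
          refine ((M.f_cont 0 h0).tendsto).comp (tendsto_nhdsWithin_iff.2 ⟨h2, ?_⟩)
          refine Filter.Eventually.of_forall fun n => ⟨?_, ?_⟩
          · have := M.smax_pos; positivity
          · exact div_le_self M.smax_pos.le (by linarith [(n.cast_nonneg : (0 : ℝ) ≤ n)])
        have : M.f M.smax ≤ M.f 0 := by
          refine ge_of_tendsto' hc fun n => ?_
          have hn : (0 : ℝ) < (n : ℝ) + 1 := by positivity
          have h3 : M.smax / (n + 1) ≤ M.smax :=
            div_le_self M.smax_pos.le (by linarith [(n.cast_nonneg : (0 : ℝ) ≤ n)])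
          have h4 : 0 < M.smax / (n + 1) := div_pos M.smax_pos hn
          rw [hf _ h1, hf _ ⟨h4.le, h3⟩]
          gcongr ?_ * ?_
          exact Real.rpow_le_rpow_of_nonpos h4 h3 hβ.le
        rw [M.f_zero] at this
        linarith
    have hα : 0 < α := hβ.trans_le hαβ
    have hr0 : M.r 0 = 0 := by rw [hr 0 h0, Real.zero_rpow hα.ne', mul_zero]
    have ha : 0 ≤ a := by
      have := M.r_mono h0 h1 M.smax_pos.le
      rw [hr0, hr _ h1] at this
      exact nonneg_of_mul_nonneg_left this (Real.rpow_pos_of_pos M.smax_pos _)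
    -- The bracket is nondecreasing in y because α ≥ β and a ≥ 0. If it is nonpositive at s, rate 0
    -- is at least as good; if it is positive there, both factors can only grow on the way to smax.
    have hfac : ∀ y, y ∈ Icc 0 M.smax → 0 < y →
        M.r y - M.f y * D = y ^ β * (a * y ^ (α - β) - b * D) := by
      intro y hy hy0
      rw [hr y hy, hf y hy, Real.rpow_sub hy0]
      have := (Real.rpow_pos_of_pos hy0 β).ne'
      field_simp
    rw [hr0, hfac s hs hs0, hfac _ h1 M.smax_pos]
    have h2 : s ^ β ≤ M.smax ^ β := Real.rpow_le_rpow hs.1 hs.2 hβ.le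
    have h3 : s ^ (α - β) ≤ M.smax ^ (α - β) := Real.rpow_le_rpow hs.1 hs.2 (by linarith)
    have h4 : 0 < s ^ β := Real.rpow_pos_of_pos hs0 _
    have h5 := mul_le_mul_of_nonneg_left h3 ha
    rcases le_or_gt (a * s ^ (α - β) - b * D) 0 with h6 | h6
    · exact le_max_of_le_left (by nlinarith)
    · refine le_max_of_le_right ?_
      exact mul_le_mul h2 (by linarith) h6.le hsp.le
  · have hc : ConvexOn ℝ (Icc 0 M.smax) fun s => M.r s - D • M.f s := hr.sub (hf.smul hD.le)
    have := hc.le_max_of_mem_Icc h0 h1 hs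
    simpa [M.f_zero, mul_comm] using this

/-! ### Expected gain over an exponential sojourn -/

lemma expMeasure_real_Ioi {x : ℝ} (hx : 0 ≤ x) : (expMeasure 1).real (Ioi x) = Real.exp (-x) := by
  have := isProbabilityMeasure_expMeasure one_pos
  have h := cdf_expMeasure_eq one_pos x
  rw [if_pos hx, cdf_eq_real, one_mul] at h
  rw [← compl_Iic, probReal_compl_eq_one_sub measurableSet_Iic, h]
  ring

lemma integral_ite_lt_expMeasure {x : ℝ} (hx : 0 ≤ x) (q : ℝ) :
    ∫ e, (if x < e then q else 0) ∂expMeasure 1 = Real.exp (-x) * q := by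
  have h : (fun e : ℝ => if x < e then q else 0) = (Ioi x).indicator fun _ => q := by
    ext e; simp [indicator_apply]
  rw [h, integral_indicator_const _ measurableSet_Ioi, expMeasure_real_Ioi hx, smul_eq_mul]

/-- Fundamental theorem of calculus for a differentiable function discounted at a bounded
measurable rate. -/
lemma integral_exp_neg_mul_eq_sub {a D D' : ℝ → ℝ} (ha : Measurable a) {K : ℝ}
    (haK : ∀ v, |a v| ≤ K) (hD' : Continuous D') (hD : ∀ v, HasDerivAt D (D' v) v) {b t : ℝ} :
    ∫ v in b..t, Real.exp (-∫ w in b..v, a w) * (D' v - a v * D v) =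
      Real.exp (-∫ w in b..t, a w) * D t - D b := by
  have hint : ∀ p q, IntervalIntegrable a volume p q := fun p q =>
    intervalIntegrable_const (c := K) |>.mono_fun ha.aestronglyMeasurable
      (Filter.Eventually.of_forall fun v => by
        simpa using (haK v).trans (le_abs_self K))
  set A : ℝ → ℝ := fun v => ∫ w in b..v, a w with hA
  have hAlip : LipschitzWith K.toNNReal A := by
    refine LipschitzWith.of_dist_le_mul fun p q => ?_
    rw [Real.dist_eq, hA, intervalIntegral.integral_interval_sub_left (hint _ _) (hint _ _),
      Real.dist_eq, Real.coe_toNNReal _ ((abs_nonneg _).trans (haK 0))]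
    exact intervalIntegral.norm_integral_le_of_norm_le_const (f := a) fun v _ => haK v
  obtain ⟨C, hC⟩ := (isCompact_uIcc (a := b) (b := t)).exists_bound_of_continuousOn
    hAlip.continuous.continuousOn
  -- The rate a is merely measurable, so the discount factor need not be differentiable everywhere;
  -- absolute continuity replaces this. The exponential is Lipschitz only on bounded sets, hence the
  -- bound C on A.
  have hE : AbsolutelyContinuousOnInterval (fun v => Real.exp (-A v)) b t := by
    obtain ⟨L, hL⟩ := (Real.contDiff_exp (n := 1)).contDiffOn.exists_lipschitzOnWith (by decide)
      (convex_Icc (-C) C) isCompact_Icc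
    have : LipschitzOnWith (L * K.toNNReal) (Real.exp ∘ fun v => -A v) (uIcc b t) :=
      hL.comp hAlip.neg.lipschitzOnWith fun v hv => by
        have := abs_le.1 (hC v hv)
        exact ⟨by linarith [this.2], by linarith [this.1]⟩
    exact this.absolutelyContinuousOnInterval
  have hDac : AbsolutelyContinuousOnInterval D b t := by
    refine ContDiffOn.absolutelyContinuousOnInterval (ContDiff.contDiffOn ?_)
    rw [contDiff_one_iff_deriv]
    refine ⟨fun v => (hD v).differentiableAt, ?_⟩
    rwa [show deriv D = D' from funext fun v => (hD v).deriv]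
  have h := (hE.fun_mul hDac).integral_deriv_eq_sub
  have hb : A b = 0 := intervalIntegral.integral_same
  rw [hb, neg_zero, Real.exp_zero, one_mul] at h
  rw [← h]
  refine intervalIntegral.integral_congr_ae ?_
  filter_upwards [(hint b t).ae_hasDerivAt_integral] with v hv hvm
  have h1 := hv (uIoc_subset_uIcc hvm) b left_mem_uIcc
  have h2 := h1.neg.exp.mul (hD v)
  rw [show (fun v => Real.exp (-A v) * D v) = (fun v => Real.exp ((-A) v)) * D from rfl, h2.deriv]
  simp only [Pi.neg_apply]
  ring

/-- The expectation of the gain over one sojourn: with an exponential threshold for the accumulated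
intensity `∫ a`, a running gain `q`, the value `V` before and the value `W` after the jump. -/
lemma integral_sojourn_gain {a q V V' W W' : ℝ → ℝ} (ha : Measurable a) {K : ℝ}
    (ha0 : ∀ v, 0 ≤ a v) (haK : ∀ v, a v ≤ K) (hq : Measurable q) {R : ℝ} (hqR : ∀ v, |q v| ≤ R)
    (hV' : Continuous V') (hV : ∀ v, HasDerivAt V (V' v) v)
    (hW' : Continuous W') (hW : ∀ v, HasDerivAt W (W' v) v) {b t : ℝ} (hbt : b ≤ t) :
    ∫ e, (W (t - b) - V (t - b) + (if ∫ w in b..t, a w < e then V 0 - W 0 else 0) +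
        ∫ v in b..t, if ∫ w in b..v, a w < e then q v - W' (t - v) else 0) ∂expMeasure 1 =
      ∫ v in b..t, Real.exp (-∫ w in b..v, a w) *
        (q v - a v * (V (t - v) - W (t - v)) - V' (t - v)) := by
  have := isProbabilityMeasure_expMeasure one_pos
  have haK' : ∀ v, |a v| ≤ K := fun v => by rw [abs_of_nonneg (ha0 v)]; exact haK v
  have hint : ∀ p q, IntervalIntegrable a volume p q := fun p q =>
    intervalIntegrable_const (c := K) |>.mono_fun ha.aestronglyMeasurable
      (Filter.Eventually.of_forall fun v => by
        simpa using (haK' v).trans (le_abs_self K))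
  have hAc : Continuous fun v => ∫ w in b..v, a w := intervalIntegral.continuous_primitive hint b
  have hA0 : ∀ v, b ≤ v → 0 ≤ ∫ w in b..v, a w := fun v hv =>
    intervalIntegral.integral_nonneg hv fun w _ => ha0 w
  obtain ⟨C, hC⟩ := (isCompact_Icc (a := b) (b := t)).exists_bound_of_continuousOn
    (f := fun v => W' (t - v)) (by fun_prop)
  have hg : Measurable fun v => q v - W' (t - v) := hq.sub (by fun_prop)
  have hmeas : Measurable fun p : ℝ × ℝ =>
      if ∫ w in b..p.2, a w < p.1 then q p.2 - W' (t - p.2) else 0 :=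
    Measurable.ite (measurableSet_lt (hAc.measurable.comp measurable_snd) measurable_fst)
      (hg.comp measurable_snd) measurable_const
  have hbnd : Integrable (Function.uncurry fun e v =>
      if ∫ w in b..v, a w < e then q v - W' (t - v) else 0)
      ((expMeasure 1).prod (volume.restrict (Ioc b t))) := by
    refine Integrable.of_bound (C := R + C) hmeas.aestronglyMeasurable ?_
    have h1 : ∀ᵐ p ∂((expMeasure 1).prod (volume.restrict (Ioc b t))), p.2 ∈ Ioc b t :=
      Measure.quasiMeasurePreserving_snd.ae (ae_restrict_mem measurableSet_Ioc)
    filter_upwards [h1] with p hp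
    have h2 := hC p.2 (Ioc_subset_Icc_self hp)
    have h3 := hqR p.2
    have h4 := norm_sub_le (q p.2) (W' (t - p.2))
    rw [Real.norm_eq_abs (q p.2)] at h4
    simp only [Function.uncurry]
    split_ifs
    · linarith
    · rw [norm_zero]; linarith [norm_nonneg (W' (t - p.2)), abs_nonneg (q p.2)]
  have hi2 : Integrable (fun e => ∫ v in b..t,
      if ∫ w in b..v, a w < e then q v - W' (t - v) else 0) (expMeasure 1) := by
    simp only [intervalIntegral.integral_of_le hbt]
    exact hbnd.integral_prod_left
  have hi1 : Integrable (fun e => if ∫ w in b..t, a w < e then V 0 - W 0 else 0)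
      (expMeasure 1) := by
    refine Integrable.of_bound (C := |V 0 - W 0|)
      (Measurable.ite measurableSet_Ioi measurable_const measurable_const).aestronglyMeasurable
      (Filter.Eventually.of_forall fun e => ?_)
    split_ifs <;> simp
  have hi12 : Integrable (fun e => W (t - b) - V (t - b) +
      if ∫ w in b..t, a w < e then V 0 - W 0 else 0) (expMeasure 1) :=
    (integrable_const _).add hi1
  rw [integral_add hi12 hi2, integral_add (integrable_const _) hi1,
    integral_const, integral_ite_lt_expMeasure (hA0 t hbt)]
  -- Fubini: the probability that the threshold exceeds the intensity accumulated up to v is the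
  -- survival probability exp(-A(v)).
  have hswap : ∫ e, (∫ v in b..t, if ∫ w in b..v, a w < e then q v - W' (t - v) else 0)
      ∂expMeasure 1 = ∫ v in b..t, Real.exp (-∫ w in b..v, a w) * (q v - W' (t - v)) := by
    simp only [intervalIntegral.integral_of_le hbt]
    rw [integral_integral_swap hbnd]
    refine setIntegral_congr_fun measurableSet_Ioc fun v hv => ?_
    have := integral_ite_lt_expMeasure (hA0 v hv.1.le) (q v - W' (t - v))
    simpa [intervalIntegral.integral_of_le hv.1.le] using this
  -- The boundary terms for D(v) = V(t - v) - W(t - v) are exactly the terms outside the running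
  -- integral, so only the integrand of the claim remains.
  have hftc := integral_exp_neg_mul_eq_sub ha haK' (b := b) (t := t)
    (D := fun v => V (t - v) - W (t - v)) (D' := fun v => -V' (t - v) + W' (t - v))
    (by fun_prop) (fun v => by
      have h1 := (hV (t - v)).comp_const_sub t v
      have h2 := (hW (t - v)).comp_const_sub t v
      exact (h1.sub h2).congr_deriv (by ring))
  have hE : Continuous fun v => Real.exp (-∫ w in b..v, a w) := Real.continuous_exp.comp hAc.neg
  have hVc : Continuous V := continuous_iff_continuousAt.2 fun v => (hV v).continuousAt
  have hWc : Continuous W := continuous_iff_continuousAt.2 fun v => (hW v).continuousAt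
  have hqi : IntervalIntegrable q volume b t :=
    intervalIntegrable_const (c := R) |>.mono_fun hq.aestronglyMeasurable
      (Filter.Eventually.of_forall fun v => by
        simpa using (hqR v).trans (le_abs_self R))
  have hi3 : IntervalIntegrable (fun v => Real.exp (-∫ w in b..v, a w) * (q v - W' (t - v)))
      volume b t :=
    (hqi.sub (Continuous.intervalIntegrable (by fun_prop) _ _)).continuousOn_mul hE.continuousOn
  have hi4 : IntervalIntegrable (fun v => Real.exp (-∫ w in b..v, a w) *
      ((-V' (t - v) + W' (t - v)) - a v * (V (t - v) - W (t - v)))) volume b t :=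
    ((Continuous.intervalIntegrable (by fun_prop) _ _).sub ((hint b t).mul_continuousOn
      (by fun_prop))).continuousOn_mul hE.continuousOn
  have hsum : ∀ v, Real.exp (-∫ w in b..v, a w) *
        (q v - a v * (V (t - v) - W (t - v)) - V' (t - v)) =
      Real.exp (-∫ w in b..v, a w) * (q v - W' (t - v)) + Real.exp (-∫ w in b..v, a w) *
      ((-V' (t - v) + W' (t - v)) - a v * (V (t - v) - W (t - v))) := fun v => by ring
  simp only [hsum]
  rw [intervalIntegral.integral_add hi3 hi4, hftc, hswap]
  simp only [sub_self, probReal_univ, one_smul]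
  ring

/-! ### Measurability and independence of the jump times -/

lemma measurable_comp_of_continuousOn {α : Type*} [MeasurableSpace α] {φ : ℝ → ℝ} {s : Set ℝ}
    (hφ : ContinuousOn φ s) {g : α → ℝ} (hg : Measurable g) (hgs : ∀ p, g p ∈ s) :
    Measurable fun p => φ (g p) :=
  (continuousOn_iff_continuous_domRestrict.1 hφ).measurable.comp (hg.subtype_mk (h := hgs))

section

variable {M : Model} {x : ℕ} (u : Policy M x)

lemma Policy.measurable_f_rate (n : ℕ) :
    Measurable fun p : (Fin n → ℝ≥0∞) × ℝ => M.base * M.f (u.rate n p.1 p.2) :=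
  (measurable_comp_of_continuousOn M.f_cont (u.measurable_rate n)
    fun p => u.rate_mem n p.1 p.2).const_mul _

lemma Policy.measurable_r_rate (n : ℕ) :
    Measurable fun p : (Fin n → ℝ≥0∞) × ℝ => M.r (u.rate n p.1 p.2) :=
  measurable_comp_of_continuousOn M.r_cont (u.measurable_rate n) fun p => u.rate_mem n p.1 p.2

lemma Model.f_nonneg (M : Model) {s : ℝ} (hs : s ∈ Icc 0 M.smax) : 0 ≤ M.f s :=
  M.f_zero ▸ M.f_mono ⟨le_rfl, M.smax_pos.le⟩ hs hs.1

lemma Model.f_le (M : Model) {s : ℝ} (hs : s ∈ Icc 0 M.smax) : M.f s ≤ M.f M.smax :=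
  M.f_mono hs ⟨M.smax_pos.le, le_rfl⟩ hs.2

lemma Model.abs_r_le (M : Model) {s : ℝ} (hs : s ∈ Icc 0 M.smax) :
    |M.r s| ≤ |M.r 0| + |M.r M.smax| := by
  have h1 := M.r_mono ⟨le_rfl, M.smax_pos.le⟩ hs hs.1
  have h2 := M.r_mono hs ⟨M.smax_pos.le, le_rfl⟩ hs.2
  rw [abs_le]
  constructor <;> linarith [neg_abs_le (M.r 0), le_abs_self (M.r M.smax), abs_nonneg (M.r 0),
    abs_nonneg (M.r M.smax)]

lemma Policy.intensity_nonneg (n : ℕ) (h : Fin n → ℝ≥0∞) (v : ℝ) :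
    0 ≤ M.base * M.f (u.rate n h v) :=
  mul_nonneg M.base_nonneg (M.f_nonneg (u.rate_mem n h v))

lemma Policy.intensity_le (n : ℕ) (h : Fin n → ℝ≥0∞) (v : ℝ) :
    M.base * M.f (u.rate n h v) ≤ M.base * M.f M.smax :=
  mul_le_mul_of_nonneg_left (M.f_le (u.rate_mem n h v)) M.base_nonneg

lemma Policy.intervalIntegrable_intensity (n : ℕ) (h : Fin n → ℝ≥0∞) (p q : ℝ) :
    IntervalIntegrable (fun v => M.base * M.f (u.rate n h v)) volume p q :=
  intervalIntegrable_const (c := M.base * M.f M.smax) |>.mono_fun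
    ((u.measurable_f_rate n).comp measurable_prodMk_left).aestronglyMeasurable
    (Filter.Eventually.of_forall fun v => by
      dsimp only
      rw [Real.norm_of_nonneg (u.intensity_nonneg n h v)]
      exact (u.intensity_le n h v).trans (le_abs_self _))

lemma iSup_le_nextJump (n : ℕ) (h : Fin n → ℝ≥0∞) (e : ℝ) : ⨆ i, h i ≤ nextJump u n h e :=
  le_iInf₂ fun _ hk => hk.1

/-- The infimum defining `nextJump` is attained: the accumulated intensity is nondecreasing, so the
condition holds at every q + ε, and continuous, so it survives ε ↓ 0. This translates events about
jump times into inequalities for the threshold. -/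
lemma nextJump_le_iff (n : ℕ) (h : Fin n → ℝ≥0∞) (e : ℝ) {q : ℝ} (hq : 0 ≤ q) :
    nextJump u n h e ≤ ENNReal.ofReal q ↔ (⨆ i, h i) ≤ ENNReal.ofReal q ∧
      e ≤ ∫ v in (⨆ i, h i).toReal..q, M.base * M.f (u.rate n h v) := by
  set T := ⨆ i, h i with hT
  have hint := u.intervalIntegrable_intensity n h
  constructor
  · intro hle
    have key : ∀ ε, 0 < ε → T ≤ ENNReal.ofReal (q + ε) ∧
        e ≤ ∫ v in T.toReal..(q + ε), M.base * M.f (u.rate n h v) := by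
      intro ε hε
      have hlt : nextJump u n h e < ENNReal.ofReal (q + ε) :=
        hle.trans_lt ((ENNReal.ofReal_lt_ofReal_iff (by linarith)).2 (by linarith))
      simp only [nextJump, iInf_lt_iff] at hlt
      obtain ⟨k, ⟨hk1, hk2⟩, hk⟩ := hlt
      refine ⟨hk1.trans hk.le, hk2.trans ?_⟩
      have hk' : (k : ℝ) < q + ε := by
        rw [← ENNReal.ofReal_coe_nnreal] at hk
        exact (ENNReal.ofReal_lt_ofReal_iff (by linarith)).1 hk
      rw [← intervalIntegral.integral_add_adjacent_intervals (hint T.toReal k) (hint k (q + ε))]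
      exact le_add_of_nonneg_right
        (intervalIntegral.integral_nonneg hk'.le fun v _ => u.intensity_nonneg n h v)
    have hlim : Filter.Tendsto (fun ε : ℝ => q + ε) (nhdsWithin 0 (Ioi 0)) (nhds q) := by
      have : Filter.Tendsto (fun ε : ℝ => q + ε) (nhds 0) (nhds (q + 0)) :=
        (continuous_const.add continuous_id).tendsto 0
      rw [add_zero] at this
      exact this.mono_left nhdsWithin_le_nhds
    constructor
    · refine ge_of_tendsto ((ENNReal.continuous_ofReal.tendsto q).comp hlim) ?_
      filter_upwards [self_mem_nhdsWithin] with ε hε using (key ε hε).1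
    · refine ge_of_tendsto
        (((intervalIntegral.continuous_primitive hint T.toReal).tendsto q).comp hlim) ?_
      filter_upwards [self_mem_nhdsWithin] with ε hε using (key ε hε).2
  · rintro ⟨h1, h2⟩
    refine iInf₂_le_of_le q.toNNReal ⟨h1, ?_⟩ le_rfl
    rwa [Real.coe_toNNReal _ hq]

lemma measurable_iSup_fin (n : ℕ) : Measurable fun h : Fin n → ℝ≥0∞ => ⨆ i, h i :=
  Measurable.iSup fun i => measurable_pi_apply i

lemma measurable_nextJump (n : ℕ) :
    Measurable fun p : (Fin n → ℝ≥0∞) × ℝ => nextJump u n p.1 p.2 := by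
  refine measurable_of_Iic fun c => ?_
  rcases eq_or_ne c ⊤ with rfl | hc
  · simp
  set q := c.toReal with hq
  have hqc : c = ENNReal.ofReal q := (ENNReal.ofReal_toReal hc).symm
  have hq0 : 0 ≤ q := ENNReal.toReal_nonneg
  have hT : Measurable fun p : (Fin n → ℝ≥0∞) × ℝ => ⨆ i, p.1 i :=
    (measurable_iSup_fin n).comp measurable_fst
  have hset : (fun p : (Fin n → ℝ≥0∞) × ℝ => nextJump u n p.1 p.2) ⁻¹' Iic c =
      -- The variable lower limit is moved into the integrand, so that the integral is over a fixed
      -- space and measurable in its parameter.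
      {p | (⨆ i, p.1 i) ≤ c} ∩ {p | p.2 ≤ ∫ v, (if (⨆ i, p.1 i).toReal < v ∧ v ≤ q then
        M.base * M.f (u.rate n p.1 v) else 0)} := by
    ext p
    simp only [mem_preimage, mem_Iic, mem_inter_iff, mem_ofPred_eq]
    rw [hqc, nextJump_le_iff u n p.1 p.2 hq0, and_congr_right_iff]
    intro hle
    have hle' : (⨆ i, p.1 i).toReal ≤ q := ENNReal.toReal_le_of_le_ofReal hq0 hle
    rw [intervalIntegral.integral_of_le hle', ← integral_indicator measurableSet_Ioc]
    simp only [indicator_apply, mem_Ioc]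
  rw [hset]
  refine (measurableSet_le hT measurable_const).inter (measurableSet_le measurable_snd ?_)
  have h1 : Measurable fun z : ((Fin n → ℝ≥0∞) × ℝ) × ℝ =>
      if (⨆ i, z.1.1 i).toReal < z.2 ∧ z.2 ≤ q then M.base * M.f (u.rate n z.1.1 z.2) else 0 := by
    refine Measurable.ite ?_ ?_ measurable_const
    · exact (measurableSet_lt (hT.comp measurable_fst).ennreal_toReal measurable_snd).inter
        (measurableSet_le measurable_snd measurable_const)
    · exact (u.measurable_f_rate n).comp
        ((measurable_fst.comp measurable_fst).prodMk measurable_snd)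
  exact (h1.stronglyMeasurable.integral_prod_right (ν := volume)).measurable

lemma jumpTimes_succ_last (ω : ℕ → ℝ) (n : ℕ) :
    jumpTimes u ω (n + 1) (Fin.last n) = nextJump u n (jumpTimes u ω n) (ω n) := by
  simp [jumpTimes]

lemma iSup_jumpTimes_zero (ω : ℕ → ℝ) : ⨆ i, jumpTimes u ω 0 i = 0 := by simp

lemma iSup_jumpTimes_succ (ω : ℕ → ℝ) (n : ℕ) :
    ⨆ i, jumpTimes u ω (n + 1) i = nextJump u n (jumpTimes u ω n) (ω n) := by
  refine le_antisymm (iSup_le fun i => ?_) ?_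
  · induction i using Fin.lastCases with
    | last => exact (jumpTimes_succ_last u ω n).le
    | cast i =>
      simp only [jumpTimes, Fin.snoc_castSucc]
      exact (le_iSup _ i).trans (iSup_le_nextJump u n _ _)
  · rw [← jumpTimes_succ_last]
    exact le_iSup (jumpTimes u ω (n + 1)) (Fin.last n)

lemma measurable_jumpTimes (n : ℕ) : Measurable fun ω : ℕ → ℝ => jumpTimes u ω n := by
  induction n with
  | zero => exact measurable_pi_iff.2 fun i => i.elim0
  | succ n ih =>
    refine measurable_pi_iff.2 fun i => ?_
    induction i using Fin.lastCases with
    | last =>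
      have h1 : Measurable fun ω : ℕ → ℝ => (jumpTimes u ω n, ω n) :=
        ih.prodMk (measurable_pi_apply n)
      have h2 := (measurable_nextJump u n).comp h1
      simp only [jumpTimes_succ_last]
      exact h2
    | cast i =>
      have h1 : Measurable fun ω : ℕ → ℝ => jumpTimes u ω n i := (measurable_pi_apply i).comp ih
      simpa only [jumpTimes, Fin.snoc_castSucc] using h1

lemma jumpTimes_congr {ω ω' : ℕ → ℝ} (n : ℕ) (h : ∀ i < n, ω i = ω' i) :
    jumpTimes u ω n = jumpTimes u ω' n := by
  induction n with
  | zero => rfl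
  | succ n ih =>
    simp only [jumpTimes, ih fun i hi => h i (hi.trans n.lt_succ_self), h n n.lt_succ_self]

instance : IsProbabilityMeasure (expMeasure 1) := isProbabilityMeasure_expMeasure one_pos

instance : IsProbabilityMeasure thresholdLaw := by
  unfold thresholdLaw
  infer_instance

/-- The first n jump times are a function of the thresholds with index below n. Padding those
coordinates with zeros (`ext`) exhibits this function explicitly. -/
lemma indepFun_jumpTimes (n : ℕ) :
    IndepFun (fun ω => jumpTimes u ω n) (fun ω => ω n) thresholdLaw := by
  have h := iIndepFun_infinitePi (P := fun _ : ℕ => expMeasure 1) (X := fun _ (y : ℝ) => y)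
    (fun _ => measurable_id)
  have h2 := h.indepFun_finset (Finset.range n) {n} (by simp) fun i => measurable_pi_apply i
  let ext : ((i : Finset.range n) → ℝ) → ℕ → ℝ := fun p i =>
    if hi : i ∈ Finset.range n then p ⟨i, hi⟩ else 0
  have hext : Measurable ext := by
    refine measurable_pi_iff.2 fun i => ?_
    by_cases hi : i ∈ Finset.range n
    · simpa only [ext, hi, dite_true] using measurable_pi_apply _
    · simp only [ext, hi, dite_false, measurable_const]
  have h3 := h2.comp ((measurable_jumpTimes u n).comp hext)
    (measurable_pi_apply (⟨n, Finset.mem_singleton_self n⟩ : ({n} : Finset ℕ)))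
  refine h3.congr (Filter.Eventually.of_forall fun ω => ?_) (Filter.EventuallyEq.refl _ _)
  refine jumpTimes_congr u n fun i hi => ?_
  simp [ext, hi]

lemma map_jumpTimes_threshold (n : ℕ) :
    thresholdLaw.map (fun ω => (jumpTimes u ω n, ω n)) =
      (thresholdLaw.map fun ω => jumpTimes u ω n).prod (expMeasure 1) := by
  rw [(indepFun_iff_map_prod_eq_prod_map_map (measurable_jumpTimes u n).aemeasurable
    (measurable_pi_apply n).aemeasurable).1 (indepFun_jumpTimes u n)]
  congr 1
  exact Measure.infinitePi_map_eval (fun _ : ℕ => expMeasure 1) n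

end

/-! ### Decomposition of the profit into sojourn gains -/

lemma integral_ite_le_ofReal {T : ℝ≥0∞} {t : ℝ} (ht : 0 ≤ t) (hT : T ≤ ENNReal.ofReal t)
    (q : ℝ → ℝ) :
    ∫ k in (0 : ℝ)..t, (if T ≤ ENNReal.ofReal k then q k else 0) = ∫ k in T.toReal..t, q k := by
  have hT' : T ≠ ⊤ := ne_top_of_le_ne_top ENNReal.ofReal_ne_top hT
  have hb := ENNReal.toReal_le_of_le_ofReal ht hT
  have h : ∫ k in (0 : ℝ)..t, (if T ≤ ENNReal.ofReal k then q k else 0) =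
      ∫ k in (0 : ℝ)..t, (Ioi T.toReal).indicator q k := by
    refine intervalIntegral.integral_congr_ae ?_
    filter_upwards [compl_mem_ae_iff.2 (measure_singleton T.toReal)] with k hk hkm
    rw [uIoc_of_le ht] at hkm
    have hk' : k ≠ T.toReal := hk
    simp only [ENNReal.le_ofReal_iff_toReal_le hT' hkm.1.le, indicator_apply, mem_Ioi,
      le_iff_lt_or_eq, hk'.symm, or_false]
  rw [h, intervalIntegral.integral_of_le ht, intervalIntegral.integral_of_le hb,
    setIntegral_indicator measurableSet_Ioi, Ioc_inter_Ioi, max_eq_right ENNReal.toReal_nonneg]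

lemma integral_ite_ofReal_lt {τ : ℝ≥0∞} {b t : ℝ} (hb : 0 ≤ b) (hbt : b ≤ t)
    (hτ : ENNReal.ofReal b ≤ τ) {W W' : ℝ → ℝ} (hW' : Continuous W')
    (hW : ∀ v, HasDerivAt W (W' v) v) :
    ∫ v in b..t, (if ENNReal.ofReal v < τ then W' (t - v) else 0) =
      W (t - b) - W (t - (min τ (ENNReal.ofReal t)).toReal) := by
  set s := (min τ (ENNReal.ofReal t)).toReal with hs
  have hfin : min τ (ENNReal.ofReal t) ≠ ⊤ :=
    ne_top_of_le_ne_top ENNReal.ofReal_ne_top (min_le_right _ _)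
  have hst : s ≤ t := ENNReal.toReal_le_of_le_ofReal (hb.trans hbt) (min_le_right _ _)
  have hbs : b ≤ s := (ENNReal.ofReal_le_iff_le_toReal hfin).1
    (le_min hτ (ENNReal.ofReal_le_ofReal hbt))
  have h : ∫ v in b..t, (if ENNReal.ofReal v < τ then W' (t - v) else 0) =
      ∫ v in b..t, (Iic s).indicator (fun v => W' (t - v)) v := by
    refine intervalIntegral.integral_congr_ae ?_
    filter_upwards [compl_mem_ae_iff.2 (measure_singleton s)] with v hv hvm
    rw [uIoc_of_le hbt] at hvm
    have hv' : v ≠ s := hv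
    have hv0 : 0 ≤ v := hb.trans hvm.1.le
    have : ENNReal.ofReal v < τ ↔ v ≤ s := by
      constructor
      · intro hlt
        rw [← ENNReal.ofReal_le_iff_le_toReal hfin]
        exact le_min hlt.le (ENNReal.ofReal_le_ofReal hvm.2)
      · intro hle
        exact ((ENNReal.ofReal_lt_iff_lt_toReal hv0 hfin).2 (lt_of_le_of_ne hle hv')).trans_le
          (min_le_left _ _)
    simp only [this, indicator_apply, mem_Iic]
  rw [h, intervalIntegral.integral_of_le hbt, setIntegral_indicator measurableSet_Iic,
    Ioc_inter_Iic, min_eq_right hst, ← intervalIntegral.integral_of_le hbs]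
  rw [intervalIntegral.integral_eq_sub_of_hasDerivAt (f := fun v => -W (t - v))
    (fun v _ => ((hW (t - v)).comp_const_sub t v).neg.congr_deriv (neg_neg _))
    (Continuous.intervalIntegrable (by fun_prop) _ _)]
  ring

/-- The value of a function of the number of points up to time `k`, sorted by that number. -/
lemma apply_card_filter_le {T : ℕ → ℝ≥0∞} (hT : Monotone T) {k : ℝ≥0∞} (h0 : T 0 ≤ k)
    (g : ℕ → ℝ) (N : ℕ) :
    g ((Finset.range N).filter fun n => T (n + 1) ≤ k).card =
      ∑ n ∈ Finset.range N, (if T n ≤ k ∧ k < T (n + 1) then g n else 0) +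
        if T N ≤ k then g N else 0 := by
  induction N with
  | zero => simp [h0]
  | succ N ih =>
    -- If point N + 1 has occurred, so have all earlier ones, and only the final term survives.
    -- Otherwise the count is unchanged and the former final term becomes the summand n = N.
    by_cases hN : T (N + 1) ≤ k
    · have hall : ∀ n ∈ Finset.range (N + 1), T (n + 1) ≤ k := fun n hn =>
        (hT (by have := Finset.mem_range.1 hn; omega)).trans hN
      rw [Finset.filter_true_of_mem hall, Finset.card_range, if_pos hN,
        Finset.sum_eq_zero fun n hn => if_neg fun h => h.2.not_ge (hall n hn), zero_add]
    · rw [Finset.range_add_one, Finset.filter_insert, if_neg hN, ih,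
        Finset.sum_insert Finset.notMem_range_self, if_neg hN, add_zero, add_comm]
      simp [not_le.1 hN]

section

variable {M : Model} {x : ℕ} (u : Policy M x)

/-- The gain, relative to the value functions `V`, over the sojourn that starts after increments at
the times `h` and ends when the accumulated intensity reaches the threshold `e`. -/
def sojournGain (V : ℕ → ℝ → ℝ) (t : ℝ) (n : ℕ) (h : Fin n → ℝ≥0∞) (e : ℝ) : ℝ :=
  (if nextJump u n h e ≤ ENNReal.ofReal t then V (x + n + 1) (t - (nextJump u n h e).toReal)
    else 0) -
  (if ⨆ i, h i ≤ ENNReal.ofReal t then V (x + n) (t - (⨆ i, h i).toReal) else 0) +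
  (∫ k in (0 : ℝ)..t, if ⨆ i, h i ≤ ENNReal.ofReal k ∧ ENNReal.ofReal k < nextJump u n h e then
    M.r (u.rate n h k) else 0) -
  (if ⨆ i, h i ≤ ENNReal.ofReal t ∧ ENNReal.ofReal t < nextJump u n h e then M.c (x + n) else 0)

variable {V V' : ℕ → ℝ → ℝ} {t : ℝ}

lemma measurable_ite_rate (n : ℕ) : Measurable fun z : ((Fin n → ℝ≥0∞) × ℝ) × ℝ =>
    if ⨆ i, z.1.1 i ≤ ENNReal.ofReal z.2 ∧ ENNReal.ofReal z.2 < nextJump u n z.1.1 z.1.2 then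
      M.r (u.rate n z.1.1 z.2) else 0 := by
  have hT : Measurable fun z : ((Fin n → ℝ≥0∞) × ℝ) × ℝ => ⨆ i, z.1.1 i :=
    (measurable_iSup_fin n).comp (measurable_fst.comp measurable_fst)
  have hτ : Measurable fun z : ((Fin n → ℝ≥0∞) × ℝ) × ℝ => nextJump u n z.1.1 z.1.2 :=
    (measurable_nextJump u n).comp measurable_fst
  have hk : Measurable fun z : ((Fin n → ℝ≥0∞) × ℝ) × ℝ => ENNReal.ofReal z.2 :=
    measurable_snd.ennreal_ofReal
  refine Measurable.ite ((measurableSet_le hT hk).inter (measurableSet_lt hk hτ)) ?_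
    measurable_const
  exact (u.measurable_r_rate n).comp ((measurable_fst.comp measurable_fst).prodMk measurable_snd)

lemma measurable_sojournGain (hV : ∀ n, Continuous (V n)) (ht : 0 ≤ t) (n : ℕ) :
    Measurable fun p : (Fin n → ℝ≥0∞) × ℝ => sojournGain u V t n p.1 p.2 := by
  have hT : Measurable fun p : (Fin n → ℝ≥0∞) × ℝ => ⨆ i, p.1 i :=
    (measurable_iSup_fin n).comp measurable_fst
  have hτ := measurable_nextJump u n
  unfold sojournGain
  refine (((Measurable.ite (measurableSet_le hτ measurable_const) ?_ measurable_const).sub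
    (Measurable.ite (measurableSet_le hT measurable_const) ?_ measurable_const)).add ?_).sub
    (Measurable.ite ((measurableSet_le hT measurable_const).inter
      (measurableSet_lt measurable_const hτ)) measurable_const measurable_const)
  · exact (hV _).measurable.comp (measurable_const.sub hτ.ennreal_toReal)
  · exact (hV _).measurable.comp (measurable_const.sub hT.ennreal_toReal)
  · simp only [intervalIntegral.integral_of_le ht]
    exact ((measurable_ite_rate u n).stronglyMeasurable.integral_prod_right
      (ν := volume.restrict (Ioc 0 t))).measurable

lemma abs_ite_rate_le (n : ℕ) (h : Fin n → ℝ≥0∞) (k : ℝ) (p : Prop) [Decidable p] :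
    |if p then M.r (u.rate n h k) else 0| ≤ |M.r 0| + |M.r M.smax| := by
  split_ifs
  · exact M.abs_r_le (u.rate_mem n h k)
  · rw [abs_zero]; positivity

lemma exists_abs_sojournGain_le (hV : ∀ n, Continuous (V n)) (ht : 0 ≤ t) (n : ℕ) :
    ∃ C, ∀ (h : Fin n → ℝ≥0∞) (e : ℝ), |sojournGain u V t n h e| ≤ C := by
  have hb : ∀ m, ∃ B, ∀ T : ℝ≥0∞,
      |if T ≤ ENNReal.ofReal t then V m (t - T.toReal) else 0| ≤ B := by
    intro m
    obtain ⟨B, hB⟩ := (isCompact_Icc (a := (0 : ℝ)) (b := t)).exists_bound_of_continuousOn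
      (hV m).continuousOn
    refine ⟨B, fun T => ?_⟩
    split_ifs with hT
    · have h1 := ENNReal.toReal_le_of_le_ofReal ht hT
      exact hB _ ⟨by linarith, by linarith [(ENNReal.toReal_nonneg : 0 ≤ T.toReal)]⟩
    · rw [abs_zero]
      exact (norm_nonneg _).trans (hB 0 ⟨le_rfl, ht⟩)
  obtain ⟨B₁, h₁⟩ := hb (x + n + 1)
  obtain ⟨B₂, h₂⟩ := hb (x + n)
  refine ⟨B₁ + B₂ + (|M.r 0| + |M.r M.smax|) * t + |M.c (x + n)|, fun h e => ?_⟩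
  unfold sojournGain
  have h₃ : |∫ k in (0 : ℝ)..t, if ⨆ i, h i ≤ ENNReal.ofReal k ∧
      ENNReal.ofReal k < nextJump u n h e then M.r (u.rate n h k) else 0|
      ≤ (|M.r 0| + |M.r M.smax|) * t := by
    have := intervalIntegral.norm_integral_le_of_norm_le_const (a := 0) (b := t)
      (f := fun k => if ⨆ i, h i ≤ ENNReal.ofReal k ∧
        ENNReal.ofReal k < nextJump u n h e then M.r (u.rate n h k) else 0)
      fun k _ => abs_ite_rate_le u n h k _
    rwa [sub_zero, abs_of_nonneg ht] at this
  have h₄ : |if ⨆ i, h i ≤ ENNReal.ofReal t ∧ ENNReal.ofReal t < nextJump u n h e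
      then M.c (x + n) else 0| ≤ |M.c (x + n)| := by
    split_ifs <;> simp
  refine (abs_sub _ _).trans (add_le_add ((abs_add_le _ _).trans (add_le_add
    ((abs_sub _ _).trans (add_le_add (h₁ _) (h₂ _))) h₃)) h₄)

/-- Survival to v means that the threshold exceeds the intensity accumulated up to v. Writing the
value after the jump as an integral of its derivative up to the jump, and using V(0) = -c for the
cost if no jump comes before t, gives the form required by `integral_sojourn_gain`. -/
lemma integral_sojournGain_of_le (hV' : ∀ n, Continuous (V' n))
    (hV : ∀ n v, HasDerivAt (V n) (V' n v) v) (ht : 0 ≤ t) {n : ℕ}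
    (hc : V (x + n) 0 = -M.c (x + n)) {h : Fin n → ℝ≥0∞} (hT : ⨆ i, h i ≤ ENNReal.ofReal t) :
    ∫ e, sojournGain u V t n h e ∂expMeasure 1 =
      ∫ v in (⨆ i, h i).toReal..t,
        Real.exp (-∫ w in (⨆ i, h i).toReal..v, M.base * M.f (u.rate n h w)) *
        (M.r (u.rate n h v) - M.base * M.f (u.rate n h v) *
          (V (x + n) (t - v) - V (x + n + 1) (t - v)) - V' (x + n) (t - v)) := by
  have hTne : ⨆ i, h i ≠ ⊤ := ne_top_of_le_ne_top ENNReal.ofReal_ne_top hT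
  have hbt := ENNReal.toReal_le_of_le_ofReal ht hT
  have hb0 : 0 ≤ (⨆ i, h i).toReal := ENNReal.toReal_nonneg
  have hrm : Measurable fun v => M.r (u.rate n h v) :=
    (u.measurable_r_rate n).comp measurable_prodMk_left
  have ham : Measurable fun v => M.base * M.f (u.rate n h v) :=
    (u.measurable_f_rate n).comp measurable_prodMk_left
  rw [← integral_sojourn_gain ham
    (u.intensity_nonneg n h) (u.intensity_le n h) hrm
    (fun v => M.abs_r_le (u.rate_mem n h v)) (hV' (x + n)) (hV _)
    (hV' (x + n + 1)) (hV _) hbt]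
  refine integral_congr_ae (Filter.Eventually.of_forall fun e => ?_)
  simp only
  have hτT := iSup_le_nextJump u n h e
  have hiff : ∀ v, (⨆ i, h i).toReal ≤ v →
      ((∫ w in (⨆ i, h i).toReal..v, M.base * M.f (u.rate n h w)) < e ↔
        ENNReal.ofReal v < nextJump u n h e) := by
    intro v hv
    rw [← not_le, ← not_le, nextJump_le_iff u n h e (hb0.trans hv),
      ENNReal.le_ofReal_iff_toReal_le hTne (hb0.trans hv)]
    simp [hv]
  have hmeas : ∀ q : ℝ → ℝ, Measurable q →
      Measurable fun v => if ENNReal.ofReal v < nextJump u n h e then q v else 0 := fun q hq =>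
    Measurable.ite (measurableSet_lt ENNReal.measurable_ofReal measurable_const) hq
      measurable_const
  have hi1 : IntervalIntegrable (fun v => if ENNReal.ofReal v < nextJump u n h e then
      M.r (u.rate n h v) else 0) volume (⨆ i, h i).toReal t :=
    intervalIntegrable_const (c := |M.r 0| + |M.r M.smax|) |>.mono_fun
      (hmeas _ hrm).aestronglyMeasurable
      (Filter.Eventually.of_forall fun v =>
        (abs_ite_rate_le u n h v _).trans (le_abs_self _))
  have hi2 : IntervalIntegrable (fun v => if ENNReal.ofReal v < nextJump u n h e then
      V' (x + n + 1) (t - v) else 0) volume (⨆ i, h i).toReal t := by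
    have hcont : Continuous fun v => V' (x + n + 1) (t - v) :=
      (hV' _).comp (continuous_const.sub continuous_id)
    refine (hcont.intervalIntegrable _ _).mono_fun (hmeas _ hcont.measurable).aestronglyMeasurable
      (Filter.Eventually.of_forall fun v => ?_)
    dsimp only
    split_ifs <;> simp
  have hint : (∫ v in (⨆ i, h i).toReal..t,
      if (∫ w in (⨆ i, h i).toReal..v, M.base * M.f (u.rate n h w)) < e then
        M.r (u.rate n h v) - V' (x + n + 1) (t - v) else 0) =
      (∫ v in (⨆ i, h i).toReal..t, if ENNReal.ofReal v < nextJump u n h e then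
        M.r (u.rate n h v) else 0) -
      (V (x + n + 1) (t - (⨆ i, h i).toReal) -
        V (x + n + 1) (t - (min (nextJump u n h e) (ENNReal.ofReal t)).toReal)) := by
    rw [← integral_ite_ofReal_lt hb0 hbt (by rwa [ENNReal.ofReal_toReal hTne]) (hV' _) (hV _),
      ← intervalIntegral.integral_sub hi1 hi2]
    refine intervalIntegral.integral_congr fun v hv => ?_
    rw [uIcc_of_le hbt] at hv
    simp only [hiff v hv.1]
    split_ifs <;> simp
  rw [hint]
  simp only [sojournGain, ite_and, if_pos hT, hiff t hbt]
  rw [integral_ite_le_ofReal ht hT]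
  rcases le_or_gt (nextJump u n h e) (ENNReal.ofReal t) with hle | hlt
  · rw [if_pos hle, if_neg hle.not_gt, if_neg hle.not_gt, min_eq_left hle]
    ring
  · rw [if_neg hlt.not_ge, if_pos hlt, if_pos hlt, min_eq_right hlt.le, ENNReal.toReal_ofReal ht,
      sub_self, hc]
    ring

lemma sojournGain_of_lt (ht : 0 ≤ t) {n : ℕ} {h : Fin n → ℝ≥0∞}
    (hT : ENNReal.ofReal t < ⨆ i, h i) (e : ℝ) : sojournGain u V t n h e = 0 := by
  have h1 : ∀ k ∈ uIcc 0 t, (if ⨆ i, h i ≤ ENNReal.ofReal k ∧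
      ENNReal.ofReal k < nextJump u n h e then M.r (u.rate n h k) else 0) = 0 := by
    intro k hk
    rw [uIcc_of_le ht] at hk
    exact if_neg fun hle =>
      ((ENNReal.ofReal_le_ofReal hk.2).trans_lt hT).not_ge hle.1
  rw [sojournGain, intervalIntegral.integral_congr h1,
    if_neg (hT.trans_le (iSup_le_nextJump u n h e)).not_ge, if_neg hT.not_ge,
    if_neg fun hle => hT.not_ge hle.1]
  simp

lemma monotone_iSup_jumpTimes (ω : ℕ → ℝ) : Monotone fun n => ⨆ i, jumpTimes u ω n i :=
  monotone_nat_of_le_succ fun n => by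
    rw [iSup_jumpTimes_succ]
    exact iSup_le_nextJump u n _ _

lemma apply_numJumps (ω : ℕ → ℝ) (k : ℝ) (g : ℕ → ℝ) :
    g (numJumps u ω k) = ∑ n ∈ Finset.range (M.ξ - x),
      (if ⨆ i, jumpTimes u ω n i ≤ ENNReal.ofReal k ∧
        ENNReal.ofReal k < nextJump u n (jumpTimes u ω n) (ω n) then g n else 0) +
      if ⨆ i, jumpTimes u ω (M.ξ - x) i ≤ ENNReal.ofReal k then g (M.ξ - x) else 0 := by
  have := apply_card_filter_le (monotone_iSup_jumpTimes u ω) (k := ENNReal.ofReal k)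
    (by rw [iSup_jumpTimes_zero]; exact zero_le) g (M.ξ - x)
  simp only [iSup_jumpTimes_succ] at this
  simpa only [numJumps, jumpTimes_succ_last] using this

/-- The realized profit is the value at the start plus the gains over the sojourns. -/
lemma realized_profit_eq (hx : x ≤ M.ξ) (ht : 0 ≤ t)
    (hξ : ∀ s, V M.ξ s = -M.c M.ξ + M.rFail * s) (ω : ℕ → ℝ) :
    (∫ k in (0 : ℝ)..t, revenueRate u ω k) - M.c (level u ω t) =
      V x t + ∑ n ∈ Finset.range (M.ξ - x), sojournGain u V t n (jumpTimes u ω n) (ω n) := by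
  set N := M.ξ - x with hN
  have hxN : x + N = M.ξ := by omega
  have hrev : ∀ k, revenueRate u ω k = ∑ n ∈ Finset.range N,
      (if ⨆ i, jumpTimes u ω n i ≤ ENNReal.ofReal k ∧
        ENNReal.ofReal k < nextJump u n (jumpTimes u ω n) (ω n) then
        M.r (u.rate n (jumpTimes u ω n) k) else 0) +
      if ⨆ i, jumpTimes u ω N i ≤ ENNReal.ofReal k then M.rFail else 0 := by
    intro k
    have := apply_numJumps u ω k fun m =>
      if x + m < M.ξ then M.r (u.rate m (jumpTimes u ω m) k) else M.rFail
    simp only [← hN, hxN, lt_irrefl, if_false] at this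
    refine this.trans ?_
    congr 1
    refine Finset.sum_congr rfl fun n hn => ?_
    have hlt : x + n < M.ξ := by have := Finset.mem_range.1 hn; omega
    simp only [hlt, if_true]
  have hcost : M.c (level u ω t) = ∑ n ∈ Finset.range N,
      (if ⨆ i, jumpTimes u ω n i ≤ ENNReal.ofReal t ∧
        ENNReal.ofReal t < nextJump u n (jumpTimes u ω n) (ω n) then M.c (x + n) else 0) +
      if ⨆ i, jumpTimes u ω N i ≤ ENNReal.ofReal t then M.c M.ξ else 0 := by
    have := apply_numJumps u ω t fun m => M.c (x + m)
    rwa [← hN, hxN] at this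
  have hi : ∀ n, IntervalIntegrable (fun k => if ⨆ i, jumpTimes u ω n i ≤ ENNReal.ofReal k ∧
        ENNReal.ofReal k < nextJump u n (jumpTimes u ω n) (ω n) then
        M.r (u.rate n (jumpTimes u ω n) k) else 0) volume 0 t := fun n =>
    intervalIntegrable_const (c := |M.r 0| + |M.r M.smax|) |>.mono_fun
      ((measurable_ite_rate u n).comp
        (measurable_prodMk_left (x := (jumpTimes u ω n, ω n)))).aestronglyMeasurable
      (Filter.Eventually.of_forall fun v =>
        (abs_ite_rate_le u n _ v _).trans (le_abs_self _))
  have hiN : IntervalIntegrable (fun k => if ⨆ i, jumpTimes u ω N i ≤ ENNReal.ofReal k then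
      M.rFail else 0) volume 0 t := by
    refine intervalIntegrable_const (c := M.rFail) |>.mono_fun
      (Measurable.ite (measurableSet_le measurable_const ENNReal.measurable_ofReal)
        measurable_const measurable_const).aestronglyMeasurable
      (Filter.Eventually.of_forall fun v => ?_)
    dsimp only
    split_ifs <;> simp
  have hsum := IntervalIntegrable.sum (Finset.range N) fun n _ => hi n
  rw [Finset.sum_fn] at hsum
  simp only [hrev]
  rw [intervalIntegral.integral_add hsum hiN,
    intervalIntegral.integral_finsetSum fun n _ => hi n, hcost]
  -- The values at successive jump times telescope, with jumps after t counted as zero.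
  have htel := Finset.sum_range_sub (fun n => if ⨆ i, jumpTimes u ω n i ≤ ENNReal.ofReal t then
    V (x + n) (t - (⨆ i, jumpTimes u ω n i).toReal) else 0) N
  -- The final value is what the failed system still earns and pays, since V at level ξ is linear
  -- with slope `rFail`.
  have hend : (if ⨆ i, jumpTimes u ω N i ≤ ENNReal.ofReal t then
      V (x + N) (t - (⨆ i, jumpTimes u ω N i).toReal) else 0) =
      (∫ k in (0 : ℝ)..t, if ⨆ i, jumpTimes u ω N i ≤ ENNReal.ofReal k then M.rFail else 0) -
      if ⨆ i, jumpTimes u ω N i ≤ ENNReal.ofReal t then M.c M.ξ else 0 := by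
    split_ifs with hle
    · rw [integral_ite_le_ofReal ht hle, intervalIntegral.integral_const, hxN, hξ, smul_eq_mul]
      ring
    · rw [intervalIntegral.integral_congr (g := fun _ => 0) fun k hk => if_neg fun hk' => hle
        (hk'.trans (ENNReal.ofReal_le_ofReal (by rw [uIcc_of_le ht] at hk; exact hk.2)))]
      simp
  rw [hend, iSup_jumpTimes_zero] at htel
  simp only [zero_le, if_true, ENNReal.toReal_zero, sub_zero, add_zero, iSup_jumpTimes_succ,
    ← add_assoc] at htel
  simp only [sojournGain, Finset.sum_sub_distrib, Finset.sum_add_distrib] at htel ⊢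
  linarith

lemma integrable_sojournGain (hV : ∀ n, Continuous (V n)) (ht : 0 ≤ t) (n : ℕ) :
    Integrable (fun ω => sojournGain u V t n (jumpTimes u ω n) (ω n)) thresholdLaw := by
  obtain ⟨C, hC⟩ := exists_abs_sojournGain_le u hV ht n
  have hm : Measurable fun ω : ℕ → ℝ => (jumpTimes u ω n, ω n) :=
    (measurable_jumpTimes u n).prodMk (measurable_pi_apply n)
  exact Integrable.of_bound (C := C)
    ((measurable_sojournGain u hV ht n).comp hm).aestronglyMeasurable
    (Filter.Eventually.of_forall fun ω => hC _ _)

/-- The history and the next threshold have a product law, so Fubini integrates the fresh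
exponential threshold first, with the history frozen. -/
lemma profit_eq (hV : ∀ n, Continuous (V n)) (hx : x ≤ M.ξ) (ht : 0 ≤ t)
    (hξ : ∀ s, V M.ξ s = -M.c M.ξ + M.rFail * s) :
    profit u t = V x t + ∑ n ∈ Finset.range (M.ξ - x),
      ∫ ω, (∫ e, sojournGain u V t n (jumpTimes u ω n) e ∂expMeasure 1) ∂thresholdLaw := by
  unfold profit
  simp only [realized_profit_eq u hx ht hξ]
  rw [integral_add (integrable_const _)
    (integrable_finsetSum _ fun n _ => integrable_sojournGain u hV ht n),
    integral_finsetSum _ fun n _ => integrable_sojournGain u hV ht n]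
  simp only [integral_const, probReal_univ, one_smul]
  congr 1
  refine Finset.sum_congr rfl fun n _ => ?_
  obtain ⟨C, hC⟩ := exists_abs_sojournGain_le u hV ht n
  have hm : Measurable fun ω : ℕ → ℝ => (jumpTimes u ω n, ω n) :=
    (measurable_jumpTimes u n).prodMk (measurable_pi_apply n)
  have hg := measurable_sojournGain u hV ht n
  have := Measure.isProbabilityMeasure_map (μ := thresholdLaw)
    (measurable_jumpTimes u n).aemeasurable
  rw [← integral_map (φ := fun ω : ℕ → ℝ => (jumpTimes u ω n, ω n))
      (f := fun p => sojournGain u V t n p.1 p.2) hm.aemeasurable hg.aestronglyMeasurable,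
    map_jumpTimes_threshold, integral_prod _ (Integrable.of_bound (C := C)
      hg.aestronglyMeasurable (Filter.Eventually.of_forall fun p => hC _ _)),
    integral_map (measurable_jumpTimes u n).aemeasurable]
  exact (hg.stronglyMeasurable.integral_prod_right (ν := expMeasure 1)).aestronglyMeasurable

end

/-! ### The greedy policy and verification -/

/-- The Markov policy that produces at the maximum rate whenever this is at least as good as not
producing, judged by the value functions `V`. -/
def greedyPolicy (M : Model) (V : ℕ → ℝ → ℝ) (hV : ∀ n, Continuous (V n)) : MarkovPolicy M where
  rate y τ := if y < M.ξ ∧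
    M.r 0 ≤ M.r M.smax - M.base * M.f M.smax * (V y τ - V (y + 1) τ) then M.smax else 0
  measurable_rate y := by
    refine Measurable.ite ?_ measurable_const measurable_const
    have hs : MeasurableSet {τ | M.r 0 ≤
        M.r M.smax - M.base * M.f M.smax * (V y τ - V (y + 1) τ)} :=
      measurableSet_le measurable_const
        (continuous_const.sub (continuous_const.mul ((hV y).sub (hV (y + 1))))).measurable
    exact (MeasurableSet.const _).inter hs
  rate_mem y τ := by
    split_ifs
    · exact ⟨M.smax_pos.le, le_rfl⟩
    · exact ⟨le_rfl, M.smax_pos.le⟩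
  off y τ h := if_neg fun h' => h'.1.not_ge h

lemma greedyPolicy_isBangBang (M : Model) (V : ℕ → ℝ → ℝ) (hV : ∀ n, Continuous (V n)) :
    (greedyPolicy M V hV).IsBangBang := by
  intro y τ
  simp only [greedyPolicy]
  split_ifs <;> simp

/-- The greedy rate attains the maximum in the Hamilton-Jacobi-Bellman equations. -/
lemma greedyPolicy_rate_spec (M : Model) (V : ℕ → ℝ → ℝ) (hV : ∀ n, Continuous (V n)) {y : ℕ}
    (hy : y < M.ξ) (τ : ℝ) :
    M.r ((greedyPolicy M V hV).rate y τ) -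
        M.base * M.f ((greedyPolicy M V hV).rate y τ) * (V y τ - V (y + 1) τ) =
      max (M.r 0) (M.r M.smax - M.base * M.f M.smax * (V y τ - V (y + 1) τ)) := by
  simp only [greedyPolicy, hy, true_and]
  split_ifs with h
  · rw [max_eq_right h]
  · rw [max_eq_left (not_le.1 h).le, M.f_zero]
    ring

end CondProd

end

open CondProd in
theorem corollary1 (M : CondProd.Model)
    (h : (∀ s ∈ Set.Icc 0 M.smax, M.r s = M.f s) ∨
      (∃ a b α β : ℝ, β ≤ α ∧
        (∀ s ∈ Set.Icc 0 M.smax, M.r s = a * s ^ α) ∧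
        (∀ s ∈ Set.Icc 0 M.smax, M.f s = b * s ^ β)) ∨
      (ConvexOn ℝ (Set.Icc 0 M.smax) M.r ∧ ConcaveOn ℝ (Set.Icc 0 M.smax) M.f)) :
    ∃ s : CondProd.MarkovPolicy M, s.IsOptimal ∧ s.IsBangBang := by
  have h1 : M.smax ∈ Icc 0 M.smax := ⟨M.smax_pos.le, le_rfl⟩
  obtain ⟨V, V', hV', hV, hV0, hode, hξ⟩ := exists_value_functions (M.r 0) (M.r M.smax) M.rFail
    (mul_nonneg M.base_nonneg (M.f_nonneg h1)) M.c M.ξ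
  have hVc : ∀ n, Continuous (V n) := fun n =>
    continuous_iff_continuousAt.2 fun t => (hV n t).continuousAt
  refine ⟨greedyPolicy M V hVc, fun x hx t ht => ?_, greedyPolicy_isBangBang M V hVc⟩
  -- Upper bound: given the history, each sojourn has nonpositive expected gain, because V solves
  -- the equation with all rates allowed. A sojourn that starts after t gains nothing.
  have hle : ∀ u : Policy M x, profit u t ≤ V x t := by
    intro u
    rw [profit_eq u hVc hx ht hξ, add_le_iff_nonpos_right]
    refine Finset.sum_nonpos fun n hn => integral_nonpos fun ω => ?_
    have hn : x + n < M.ξ := by have := Finset.mem_range.1 hn; omega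
    rcases le_or_gt (⨆ i, jumpTimes u ω n i) (ENNReal.ofReal t) with hT | hT
    · beta_reduce
      rw [integral_sojournGain_of_le u hV' hV ht (hV0 _ hn.le) hT]
      have hbt := ENNReal.toReal_le_of_le_ofReal ht hT
      rw [intervalIntegral.integral_of_le hbt]
      refine setIntegral_nonpos measurableSet_Ioc fun v hv => ?_
      refine mul_nonpos_of_nonneg_of_nonpos (Real.exp_nonneg _) ?_
      rw [hode _ hn _ (by linarith [hv.2]), sub_nonpos]
      -- The base rate is absorbed into D, which may have either sign.
      have := M.sub_mul_le_max h (M.base * (V (x + n) (t - v) - V (x + n + 1) (t - v)))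
        (u.rate_mem n (jumpTimes u ω n) v)
      simpa only [← mul_assoc, mul_comm _ M.base] using this
    · simp [sojournGain_of_lt u ht hT]
  -- For the greedy rate the same integrand vanishes identically, so the bound is attained.
  have heq : profit ((greedyPolicy M V hVc).toPolicy x t) t = V x t := by
    set u := (greedyPolicy M V hVc).toPolicy x t with hu
    rw [profit_eq u hVc hx ht hξ, add_eq_left]
    refine Finset.sum_eq_zero fun n hn => integral_eq_zero_of_ae
      (Filter.Eventually.of_forall fun ω => ?_)
    have hn : x + n < M.ξ := by have := Finset.mem_range.1 hn; omega
    rcases le_or_gt (⨆ i, jumpTimes u ω n i) (ENNReal.ofReal t) with hT | hT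
    · beta_reduce
      rw [integral_sojournGain_of_le u hV' hV ht (hV0 _ hn.le) hT]
      have hbt := ENNReal.toReal_le_of_le_ofReal ht hT
      rw [intervalIntegral.integral_congr (g := fun _ => 0) fun v hv => ?_]
      · simp
      · rw [uIcc_of_le hbt] at hv
        have := greedyPolicy_rate_spec M V hVc hn (t - v)
        simp only [hu, MarkovPolicy.toPolicy, hode _ hn _ (sub_nonneg.2 hv.2), this, sub_self,
          mul_zero]
    · simp [sojournGain_of_lt u ht hT]
  rw [heq]
  exact ⟨⟨_, heq⟩, by rintro _ ⟨u, rfl⟩; exact hle u⟩
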